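/- Let $n\ge 1$ and $\ell\ge 3$ be integers. The Sierpiński graph $S(n,\ell)$ has as vertices all words $u=u_0u_1\cdots u_{n-1}$ of length $n$ over $\{0,1,\dots,\ell-1\}$; two words $u,v$ are adjacent if and only if there is $d\in\{0,1,\dots,n-1\}$ such that $u_j=v_j$ for all $j<d$, $u_d\neq v_d$, and $u_j=v_d$ and $v_j=u_d$ for all $j>d$. For a finite simple graph $G$ and $S\subseteq V(G)$ with $|S|\ge 2$, an $S$-Steiner tree is a subgraph of $G$ that is a tree and whose vertex set contains $S$. Let $\lambda_G(S)$ be the maximum number of pairwise edge-disjoint $S$-Steiner trees in $G$, and let $\kappa_G(S)$ be the maximum number of internally disjoint ones, that is, $S$-Steiner trees $T_1,\dots,T_m$ with $E(T_i)\cap E(T_j)=\emptyset$ and $V(T_i)\cap V(T_j)=S$ for all $i\ne j$. For $2\le k\le |V(G)|$ put $$\kappa_k(G)=\min\{\kappa_G(S): S\subseteq V(G),\ |S|=k\},\qquad \lambda_k(G)=\min\{\lambda_G(S): S\subseteq V(G),\ |S|=k\}.$$ Then the following hold. (i) For every integer $k$ with $3\le k\le \ell$, $$\kappa_k(S(n,\ell))=\lambda_k(S(n,\ell))=\ell-\lceil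 k/2\rceil .$$ (ii) For every integer $k$ with $\ell+1\le k\le \ell^n$, $$\kappa_k(S(n,\ell))\le\lfloor \ell/2\rfloor\qquad\text{and}\qquad \lambda_k(S(n,\ell))=\lfloor \ell/2\rfloor .$$ -/

import Mathlib

namespace SteinerPacking

variable {V : Type*}

/-- `T` is an `S`-Steiner tree of `G`: a subgraph of `G` that is a tree and contains `S`. -/
def IsSteinerTree (G : SimpleGraph V) (S : Finset V) (T : G.Subgraph) : Prop :=
  T.coe.IsTree ∧ (S : Set V) ⊆ T.verts

/-- `T 0, …, T (m - 1)` are pairwise edge-disjoint `S`-Steiner trees of `G`. -/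
def EdgeDisjointTrees (G : SimpleGraph V) (S : Finset V) {m : ℕ}
    (T : Fin m → G.Subgraph) : Prop :=
  (∀ i, IsSteinerTree G S (T i)) ∧
    ∀ i j, i ≠ j → (T i).edgeSet ∩ (T j).edgeSet = ∅

/-- `T 0, …, T (m - 1)` are internally disjoint `S`-Steiner trees of `G`: pairwise edge-disjoint,
and any two of them have exactly the vertices of `S` in common. -/
def InternallyDisjointTrees (G : SimpleGraph V) (S : Finset V) {m : ℕ}
    (T : Fin m → G.Subgraph) : Prop :=
  (∀ i, IsSteinerTree G S (T i)) ∧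
    ∀ i j, i ≠ j →
      (T i).edgeSet ∩ (T j).edgeSet = ∅ ∧ (T i).verts ∩ (T j).verts = (S : Set V)

/-- `κ_G(S)`: the maximum number of internally disjoint `S`-Steiner trees of `G`. -/
noncomputable def localConn (G : SimpleGraph V) (S : Finset V) : ℕ∞ :=
  sSup {x : ℕ∞ | ∃ m : ℕ, x = m ∧ ∃ T : Fin m → G.Subgraph, InternallyDisjointTrees G S T}

/-- `λ_G(S)`: the maximum number of edge-disjoint `S`-Steiner trees of `G`. -/
noncomputable def localEdgeConn (G : SimpleGraph V) (S : Finset V) : ℕ∞ :=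
  sSup {x : ℕ∞ | ∃ m : ℕ, x = m ∧ ∃ T : Fin m → G.Subgraph, EdgeDisjointTrees G S T}

/-- The generalized `k`-connectivity `κ_k(G)`: the minimum of `κ_G(S)` over the vertex sets `S`
with `k` elements. -/
noncomputable def genConn (k : ℕ) (G : SimpleGraph V) : ℕ∞ :=
  sInf {x : ℕ∞ | ∃ S : Finset V, S.card = k ∧ x = localConn G S}

/-- The generalized `k`-edge-connectivity `λ_k(G)`: the minimum of `λ_G(S)` over the vertex sets
`S` with `k` elements. -/
noncomputable def genEdgeConn (k : ℕ) (G : SimpleGraph V) : ℕ∞ :=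
  sInf {x : ℕ∞ | ∃ S : Finset V, S.card = k ∧ x = localEdgeConn G S}

/-- The Sierpiński graph `S(n, ℓ)` on the words of length `n` over `{0, …, ℓ - 1}`: `u` and `v`
are adjacent iff for some position `d` they agree before `d`, differ at `d`, and after `d` the
word `u` is constantly `v d` and the word `v` is constantly `u d`. -/
def sierpinskiGraph (n ℓ : ℕ) : SimpleGraph (Fin n → Fin ℓ) where
  Adj u v := ∃ d : Fin n,
    (∀ j, j < d → u j = v j) ∧ u d ≠ v d ∧ ∀ j, d < j → u j = v d ∧ v j = u d
  symm := ⟨fun _ _ ⟨d, h₁, h₂, h₃⟩ =>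
    ⟨d, fun j hj => (h₁ j hj).symm, h₂.symm, fun j hj => ⟨(h₃ j hj).2, (h₃ j hj).1⟩⟩⟩
  loopless := ⟨fun _ ⟨_, _, h, _⟩ => h rfl⟩

end SteinerPacking

/-! Upper bounds: contracting each copy `{a} × words of length n - 1` turns `S(n, ℓ)` into the
complete graph `K_ℓ`, with one edge for every pair of letters, and edge-disjoint Steiner trees into
edge-disjoint subgraphs connecting a set `R` of `r` letters. Giving the edges inside `R` weight `r`
and those leaving `R` weight `r - 1`, every such subgraph has weight at least `r (r - 1)`, so there
are at most `ℓ - ⌈r / 2⌉` of them.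

Lower bounds: `S(n + 1, ℓ)` arises from `S(n, ℓ)` by replacing every word `w` by a clique, the edges
at `w` becoming edges at different vertices of the clique, its ports. Given disjoint connecting
subgraphs of `S(n, ℓ)`, coloured by `1, …, m`, a colour is extended through the clique at `w` by the
star at a nonterminal or by one of the `⌊s / 2⌋` disjoint zigzag paths through the `s` terminals of
the clique. Stars at coloured ports outside the terminals are claimed by the colour of the port.
When all words are terminals, the `⌊ℓ / 2⌋` zigzag paths suffice in every clique. In general, each
terminal word must keep an uncoloured port for the recursion to continue. The shorter words have at
most as many terminals, hence at least as many colours, and choosing which of these colours to drop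
makes this possible. -/

namespace SteinerPacking

open Function (Injective partialInv)
open scoped Finset

section SteinerTrees

variable {V : Type*} {G H : SimpleGraph V} {S : Finset V}

theorem exists_isSteinerTree_of_reachable (hHG : H ≤ G) {x : V}
    (hS : ∀ y ∈ S, H.Reachable x y) :
    ∃ T : G.Subgraph, IsSteinerTree G S T ∧ T.spanningCoe ≤ H ∧
      T.verts = {v | H.Reachable x v} := by
  let C := H.connectedComponentMk x
  have mem_supp (v : V) : v ∈ C.supp ↔ H.Reachable x v := by
    rw [SimpleGraph.ConnectedComponent.mem_supp_iff, SimpleGraph.ConnectedComponent.eq]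
    exact SimpleGraph.reachable_comm
  obtain ⟨T₀, hT₀le, hT₀⟩ := C.connected_toSimpleGraph.exists_isTree_le
  let T : G.Subgraph :=
    { verts := C.supp
      Adj := fun u v => ∃ (hu : u ∈ C.supp) (hv : v ∈ C.supp), T₀.Adj ⟨u, hu⟩ ⟨v, hv⟩
      adj_sub := fun ⟨_, _, h⟩ => hHG (hT₀le h)
      edge_vert := fun ⟨hu, _, _⟩ => hu
      symm := ⟨fun _ _ ⟨hu, hv, h⟩ => ⟨hv, hu, h.symm⟩⟩ }
  have coe_eq : T.coe = T₀ := by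
    ext u v
    exact ⟨fun ⟨_, _, h⟩ => h, fun h => ⟨u.2, v.2, h⟩⟩
  exact ⟨T, ⟨coe_eq ▸ hT₀, fun y hy => (mem_supp y).2 (hS y hy)⟩,
    fun _ _ ⟨_, _, h⟩ => hT₀le h, Set.ext mem_supp⟩

theorem mem_support_of_reachable_of_ne {u v : V} (h : H.Reachable u v) (hne : u ≠ v) :
    u ∈ H.support := by
  obtain ⟨p⟩ := h
  cases p with
  | nil => exact absurd rfl hne
  | cons h _ => exact h.mem_support_left

theorem exists_internallyDisjointTrees_of_reachable {m : ℕ} {H : Fin m → SimpleGraph V}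
    (hHG : ∀ j, H j ≤ G) (hS : S.Nonempty)
    (hconn : ∀ j, ∀ x ∈ S, ∀ y ∈ S, (H j).Reachable x y)
    (hdisj : ∀ i j, i ≠ j → Disjoint (H i) (H j))
    (hsupp : ∀ i j, i ≠ j → (H i).support ∩ (H j).support ⊆ S) :
    ∃ T : Fin m → G.Subgraph, InternallyDisjointTrees G S T := by
  obtain ⟨x, hx⟩ := hS
  choose T hT hTH hverts using fun j =>
    exists_isSteinerTree_of_reachable (hHG j) (hconn j x hx)
  refine ⟨T, hT, fun i j hij => ⟨?_, ?_⟩⟩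
  · rw [← Set.disjoint_iff_inter_eq_empty, ← SimpleGraph.Subgraph.edgeSet_spanningCoe,
      ← SimpleGraph.Subgraph.edgeSet_spanningCoe, SimpleGraph.disjoint_edgeSet]
    exact (hdisj i j hij).mono (hTH i) (hTH j)
  · refine Set.Subset.antisymm (fun v ⟨hvi, hvj⟩ => ?_) (Set.subset_inter (hT i).2 (hT j).2)
    by_contra hvS
    have hvx : v ≠ x := fun h => hvS (h ▸ hx)
    rw [hverts] at hvi hvj
    exact hvS (hsupp i j hij ⟨mem_support_of_reachable_of_ne hvi.symm hvx,
      mem_support_of_reachable_of_ne hvj.symm hvx⟩)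

theorem InternallyDisjointTrees.edgeDisjointTrees {m : ℕ} {T : Fin m → G.Subgraph}
    (h : InternallyDisjointTrees G S T) : EdgeDisjointTrees G S T :=
  ⟨h.1, fun i j hij => (h.2 i j hij).1⟩

theorem EdgeDisjointTrees.mono {S' : Finset V} (hS : S' ⊆ S) {m : ℕ} {T : Fin m → G.Subgraph}
    (h : EdgeDisjointTrees G S T) : EdgeDisjointTrees G S' T :=
  ⟨fun i => ⟨(h.1 i).1, (Finset.coe_subset.2 hS).trans (h.1 i).2⟩, h.2⟩

theorem localConn_le_localEdgeConn (G : SimpleGraph V) (S : Finset V) :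
    localConn G S ≤ localEdgeConn G S :=
  sSup_le_sSup fun _ ⟨m, hm, T, hT⟩ => ⟨m, hm, T, hT.edgeDisjointTrees⟩

theorem genConn_le_genEdgeConn (k : ℕ) (G : SimpleGraph V) : genConn k G ≤ genEdgeConn k G := by
  refine le_sInf ?_
  rintro _ ⟨S, hS, rfl⟩
  have genConn_le : genConn k G ≤ localConn G S := sInf_le ⟨S, hS, rfl⟩
  exact genConn_le.trans (localConn_le_localEdgeConn G S)

end SteinerTrees

section Contraction

variable {V W : Type*}

theorem reachable_map_of_reachable {G : SimpleGraph V} (f : V → W) {u v : V}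
    (h : G.Reachable u v) : (G.map f).Reachable (f u) (f v) := by
  obtain ⟨p⟩ := h
  induction p with
  | nil => rfl
  | @cons u v _ huv _ ih =>
    by_cases hne : f u = f v
    · rwa [hne]
    · exact (SimpleGraph.map_adj_apply' huv hne).reachable.trans ih

theorem exists_adj_dist_lt {D : SimpleGraph W} {x q : W} (h : D.Reachable x q) (hne : x ≠ q) :
    ∃ y, D.Adj x y ∧ D.dist y q < D.dist x q := by
  obtain ⟨p, hp⟩ := h.exists_walk_length_eq_dist
  cases p with
  | nil => exact absurd rfl hne
  | @cons _ y _ hxy p =>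
    rw [SimpleGraph.Walk.length_cons] at hp
    exact ⟨y, hxy, by have := SimpleGraph.dist_le p; lia⟩

section Counting

variable [Fintype W] [DecidableEq W]

/-- The pairs of distinct vertices of `R`, i.e. the possible edges inside `R`. -/
def pairsWithin (R : Finset W) : Finset (Sym2 W) :=
  R.offDiag.image (Function.uncurry Sym2.mk)

/-- The pairs with exactly one element in `R`, i.e. the possible edges leaving `R`. -/
def pairsLeaving (R : Finset W) : Finset (Sym2 W) :=
  (R ×ˢ Rᶜ).image (Function.uncurry Sym2.mk)

theorem card_pairsLeaving_le (R : Finset W) :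
    #(pairsLeaving R) ≤ #R * (Fintype.card W - #R) := by
  rw [← Finset.card_compl, ← Finset.card_product]
  exact Finset.card_image_le

-- The edges chosen are the first steps of shortest paths from the vertices of `R` to `q`.
open scoped Classical in
theorem card_erase_le_card_edgeFinset_inter {D : SimpleGraph W} {R : Finset W} {q : W}
    (h : ∀ x ∈ R, D.Reachable x q) :
    #(R.erase q) ≤ #(D.edgeFinset ∩ pairsWithin R) + #(D.edgeFinset ∩ pairsLeaving R) := by
  have exists_next (x : R.erase q) : ∃ y, D.Adj x y ∧ D.dist y q < D.dist x q :=
    exists_adj_dist_lt (h x (Finset.mem_of_mem_erase x.2)) (Finset.ne_of_mem_erase x.2)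
  choose next hadj hdist using exists_next
  have edge_injective : Injective fun x : R.erase q => s((x : W), next x) := by
    intro x y hxy
    rcases Sym2.eq_iff.1 hxy with ⟨h, -⟩ | ⟨hx, hy⟩
    · exact Subtype.ext h
    · have h₁ := hdist x
      have h₂ := hdist y
      rw [hy] at h₁
      rw [← hx] at h₂
      exact absurd h₁ h₂.not_gt
  rw [← Fintype.card_coe, ← Finset.card_univ, ← Finset.card_image_of_injective _ edge_injective]
  refine (Finset.card_le_card fun e he => ?_).trans (Finset.card_union_le _ _)
  obtain ⟨x, -, rfl⟩ := Finset.mem_image.1 he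
  have hxR := Finset.mem_of_mem_erase x.2
  by_cases hnext : next x ∈ R
  · refine Finset.mem_union_left _ (Finset.mem_inter.2 ⟨SimpleGraph.mem_edgeFinset.2 (hadj x), ?_⟩)
    exact Finset.mem_image.2 ⟨(x, next x), by simp [hxR, hnext, (hadj x).ne], rfl⟩
  · refine Finset.mem_union_right _ (Finset.mem_inter.2 ⟨SimpleGraph.mem_edgeFinset.2 (hadj x), ?_⟩)
    exact Finset.mem_image.2 ⟨(x, next x), by simp [hxR, hnext], rfl⟩

-- Without a leaving edge there are `#R - 1` inner edges; with one there are `#R` edges in all.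
open scoped Classical in
theorem card_mul_pred_le_weighted_card_edges {D : SimpleGraph W} {R : Finset W}
    (h : ∀ x ∈ R, ∀ y ∈ R, D.Reachable x y) :
    #R * (#R - 1) ≤ #R * #(D.edgeFinset ∩ pairsWithin R) +
      (#R - 1) * #(D.edgeFinset ∩ pairsLeaving R) := by
  rcases R.eq_empty_or_nonempty with rfl | ⟨x, hx⟩
  · simp
  rcases (D.edgeFinset ∩ pairsLeaving R).eq_empty_or_nonempty with hleave | ⟨e, he⟩
  · have hle := card_erase_le_card_edgeFinset_inter fun y hy => h y hy x hx
    rw [Finset.card_erase_of_mem hx, hleave, Finset.card_empty, add_zero] at hle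
    exact (Nat.mul_le_mul_left _ hle).trans (Nat.le_add_right _ _)
  · obtain ⟨hD, he⟩ := Finset.mem_inter.1 he
    obtain ⟨⟨y, z⟩, hyz, rfl⟩ := Finset.mem_image.1 he
    obtain ⟨hy, hz⟩ : y ∈ R ∧ z ∉ R := by simpa using hyz
    have hyz : D.Adj y z := SimpleGraph.mem_edgeFinset.1 hD
    have hle := card_erase_le_card_edgeFinset_inter
      fun x hx => (h x hx y hy).trans hyz.reachable
    rw [Finset.erase_eq_of_notMem hz] at hle
    calc #R * (#R - 1)
        ≤ (#(D.edgeFinset ∩ pairsWithin R) + #(D.edgeFinset ∩ pairsLeaving R)) * (#R - 1) := by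
          gcongr
      _ = (#R - 1) * #(D.edgeFinset ∩ pairsWithin R) +
          (#R - 1) * #(D.edgeFinset ∩ pairsLeaving R) := by ring
      _ ≤ _ := by gcongr; exact Nat.sub_le _ _

open scoped Classical in
theorem sum_card_edgeFinset_inter_le {ι : Type*} [Fintype ι] {D : ι → SimpleGraph W}
    (hD : ∀ i j, i ≠ j → Disjoint (D i) (D j)) (X : Finset (Sym2 W)) :
    ∑ j, #((D j).edgeFinset ∩ X) ≤ #X := by
  rw [← Finset.card_biUnion fun i _ j _ hij =>
    (SimpleGraph.disjoint_edgeFinset.2 (hD i j hij)).mono Finset.inter_subset_left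
      Finset.inter_subset_left]
  exact Finset.card_le_card (Finset.biUnion_subset.2 fun _ _ => Finset.inter_subset_right)

end Counting

theorem card_le_of_disjoint_of_reachable [Fintype W] {ι : Type*} [Fintype ι]
    {D : ι → SimpleGraph W} (hD : ∀ i j, i ≠ j → Disjoint (D i) (D j)) {R : Finset W}
    (hR : 2 ≤ #R) (hconn : ∀ j, ∀ x ∈ R, ∀ y ∈ R, (D j).Reachable x y) :
    Fintype.card ι ≤ Fintype.card W - (#R + 1) / 2 := by
  classical
  have within_le : ∑ j, #((D j).edgeFinset ∩ pairsWithin R) ≤ (#R).choose 2 :=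
    (sum_card_edgeFinset_inter_le hD _).trans (Sym2.card_image_offDiag R).le
  have leaving_le : ∑ j, #((D j).edgeFinset ∩ pairsLeaving R) ≤
      #R * (Fintype.card W - #R) :=
    (sum_card_edgeFinset_inter_le hD _).trans (card_pairsLeaving_le R)
  have le_weighted : Fintype.card ι * (#R * (#R - 1)) ≤
      #R * ∑ j, #((D j).edgeFinset ∩ pairsWithin R) +
        (#R - 1) * ∑ j, #((D j).edgeFinset ∩ pairsLeaving R) := by
    rw [Finset.mul_sum, Finset.mul_sum, ← Finset.sum_add_distrib]
    simpa using Finset.card_nsmul_le_sum Finset.univ _ _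
      fun j _ => card_mul_pred_le_weighted_card_edges (hconn j)
  have choose_two : (#R).choose 2 * 2 = #R * (#R - 1) := by
    rw [Nat.choose_two_right, Nat.div_mul_cancel (Nat.even_mul_pred_self _).two_dvd]
  have hmul : #R * (#R - 1) * (2 * Fintype.card ι) ≤
      #R * (#R - 1) * (#R + 2 * (Fintype.card W - #R)) :=
    calc #R * (#R - 1) * (2 * Fintype.card ι)
        = 2 * (Fintype.card ι * (#R * (#R - 1))) := by ring
      _ ≤ 2 * (#R * (#R).choose 2 + (#R - 1) * (#R * (Fintype.card W - #R))) := by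
          gcongr
          exact le_weighted.trans (by gcongr)
      _ = #R * ((#R).choose 2 * 2) + 2 * ((#R - 1) * (#R * (Fintype.card W - #R))) := by ring
      _ = #R * (#R - 1) * (#R + 2 * (Fintype.card W - #R)) := by rw [choose_two]; ring
  have := Nat.le_of_mul_le_mul_left hmul (Nat.mul_pos (by lia) (by lia))
  have := R.card_le_univ
  lia

theorem EdgeDisjointTrees.le_of_contraction [Fintype W] {G : SimpleGraph V} {S : Finset V} {m : ℕ}
    {T : Fin m → G.Subgraph} (hT : EdgeDisjointTrees G S T) {f : V → W}
    (hf : ∀ u v u' v', G.Adj u v → G.Adj u' v' → f u ≠ f v → f u = f u' → f v = f v' →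
      u = u' ∧ v = v')
    {R : Finset W} (hR : 2 ≤ #R) (hRS : ∀ a ∈ R, ∃ u ∈ S, f u = a) :
    m ≤ Fintype.card W - (#R + 1) / 2 := by
  let D (j : Fin m) : SimpleGraph W := (T j).coe.map fun v : (T j).verts => f v
  have hdisj (i j : Fin m) (hij : i ≠ j) : Disjoint (D i) (D j) := by
    rw [SimpleGraph.disjoint_left]
    rintro _ _ ⟨hne, u, v, huv, rfl, rfl⟩ ⟨-, u', v', huv', hu, hv⟩
    obtain ⟨huu', hvv'⟩ := hf _ _ _ _ huv.adj_sub huv'.adj_sub hne hu.symm hv.symm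
    have hmem : s((u : V), (v : V)) ∈ (T i).edgeSet ∩ (T j).edgeSet :=
      ⟨huv, by rw [huu', hvv']; exact huv'⟩
    exact Set.notMem_empty _ (hT.2 i j hij ▸ hmem)
  have hconn (j : Fin m) : ∀ x ∈ R, ∀ y ∈ R, (D j).Reachable x y := by
    intro x hx y hy
    obtain ⟨u, hu, rfl⟩ := hRS x hx
    obtain ⟨v, hv, rfl⟩ := hRS y hy
    exact reachable_map_of_reachable (fun v : (T j).verts => f v)
      ((hT.1 j).1.connected.preconnected ⟨u, (hT.1 j).2 hu⟩ ⟨v, (hT.1 j).2 hv⟩)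
  simpa using card_le_of_disjoint_of_reachable hdisj hR hconn

end Contraction

section CliqueFilling

variable {α κ : Type*}

/-- The edges of colour `j` in a partial edge colouring of a complete graph. -/
def colorClass (c : Sym2 α → Option κ) (j : κ) : SimpleGraph α :=
  SimpleGraph.fromEdgeSet {e | c e = some j}

theorem colorClass_adj {c : Sym2 α → Option κ} {j : κ} {a b : α} :
    (colorClass c j).Adj a b ↔ c s(a, b) = some j ∧ a ≠ b := by
  simp [colorClass]

/-- The partial edge colouring `c` of a clique with terminals `A` extends the colouring `p` of its
ports. The port of `a`, an edge from `a` out of the clique, is encoded as the loop `s(a, a)`. -/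
structure IsCliqueFilling (A : Finset α) (p : α → Option κ) (c : Sym2 α → Option κ) : Prop where
  diag : ∀ a, c s(a, a) = p a
  disj : ∀ a ∉ A, ∀ b b' j j', c s(a, b) = some j → c s(a, b') = some j' → j = j'
  conn : ∀ j x y, (x ∈ A ∨ p x = some j) → (y ∈ A ∨ p y = some j) → (colorClass c j).Reachable x y

section Construction

variable [DecidableEq α] [DecidableEq κ] {A : Finset α} {p hub own : α → Option κ}
  {inner : Sym2 α → Option κ}

/-- The colouring of a clique with ports coloured by `p` in which a vertex `b` outside `A` is
joined to all of `A` in colour `hub b`, the vertices outside `A` with the same colour `own` are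
joined to each other, and `inner` colours the edges inside `A`. -/
def cliqueColoring (A : Finset α) (p hub own : α → Option κ) (inner : Sym2 α → Option κ) :
    Sym2 α → Option κ :=
  Sym2.lift ⟨fun a b =>
    if a = b then p a
    else if a ∈ A then if b ∈ A then inner s(a, b) else hub b
    else if b ∈ A then hub a
    else if own a = own b then own a else none, fun a b => by
      by_cases hab : a = b <;> by_cases ha : a ∈ A <;> by_cases hb : b ∈ A <;>
        grind [Sym2.eq_swap]⟩

theorem cliqueColoring_self (a : α) : cliqueColoring A p hub own inner s(a, a) = p a := by
  simp [cliqueColoring]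

theorem cliqueColoring_of_mem {a b : α} (hab : a ≠ b) (ha : a ∈ A) (hb : b ∈ A) :
    cliqueColoring A p hub own inner s(a, b) = inner s(a, b) := by
  simp [cliqueColoring, hab, ha, hb]

theorem cliqueColoring_of_notMem {a b : α} (ha : a ∈ A) (hb : b ∉ A) :
    cliqueColoring A p hub own inner s(a, b) = hub b := by
  simp [cliqueColoring, ha, hb, ne_of_mem_of_not_mem ha hb]

theorem cliqueColoring_of_notMem_of_notMem {a b : α} (hab : a ≠ b) (ha : a ∉ A) (hb : b ∉ A) :
    cliqueColoring A p hub own inner s(a, b) = if own a = own b then own a else none := by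
  simp [cliqueColoring, hab, ha, hb]

theorem own_eq_of_cliqueColoring_eq_some (hp : ∀ b ∉ A, ∀ j, p b = some j → own b = some j)
    (hhub : ∀ b ∉ A, ∀ j, hub b = some j → own b = some j) {a b : α} (ha : a ∉ A) {j : κ}
    (hc : cliqueColoring A p hub own inner s(a, b) = some j) : own a = some j := by
  rcases eq_or_ne a b with rfl | hab
  · exact hp a ha j (by rwa [cliqueColoring_self] at hc)
  by_cases hb : b ∈ A
  · exact hhub a ha j (by rwa [Sym2.eq_swap, cliqueColoring_of_notMem hb ha] at hc)
  · rw [cliqueColoring_of_notMem_of_notMem hab ha hb] at hc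
    split_ifs at hc
    exact hc

theorem reachable_hub_colorClass_cliqueColoring
    (hp : ∀ b ∉ A, ∀ j, p b = some j → own b = some j)
    (hhub : ∀ b ∉ A, ∀ j, hub b = some j → own b = some j) {b x : α} {j : κ} (hb : b ∉ A)
    (hj : hub b = some j) (hx : x ∈ A ∨ p x = some j) :
    (colorClass (cliqueColoring A p hub own inner) j).Reachable x b := by
  rcases eq_or_ne x b with rfl | hxb
  · rfl
  refine (colorClass_adj.2 ⟨?_, hxb⟩).reachable
  by_cases hxA : x ∈ A
  · rw [cliqueColoring_of_notMem hxA hb, hj]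
  · have own_x := hp x hxA j (hx.resolve_left hxA)
    rw [cliqueColoring_of_notMem_of_notMem hxb hxA hb, own_x, hhub b hb j hj, if_pos rfl]

theorem isCliqueFilling_cliqueColoring
    (hp : ∀ b ∉ A, ∀ j, p b = some j → own b = some j)
    (hhub : ∀ b ∉ A, ∀ j, hub b = some j → own b = some j)
    (hconn : ∀ j, (∃ b ∉ A, hub b = some j) ∨ (∀ b, p b = some j → b ∈ A) ∧
      ∀ x ∈ A, ∀ y ∈ A,
        (SimpleGraph.fromEdgeSet {e | e ∈ A.sym2 ∧ inner e = some j}).Reachable x y) :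
    IsCliqueFilling A p (cliqueColoring A p hub own inner) where
  diag := cliqueColoring_self
  disj a ha b b' j j' hj hj' := Option.some_injective _ <|
    (own_eq_of_cliqueColoring_eq_some hp hhub ha hj).symm.trans
      (own_eq_of_cliqueColoring_eq_some hp hhub ha hj')
  conn j x y hx hy := by
    rcases hconn j with ⟨b, hb, hj⟩ | ⟨hport, hinner⟩
    · exact (reachable_hub_colorClass_cliqueColoring hp hhub hb hj hx).trans
        (reachable_hub_colorClass_cliqueColoring hp hhub hb hj hy).symm
    · refine (hinner x (hx.elim id (hport x)) y (hy.elim id (hport y))).mono ?_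
      intro a b hab
      obtain ⟨⟨hmem, hj⟩, hne⟩ := (SimpleGraph.fromEdgeSet_adj _).1 hab
      obtain ⟨ha, hb⟩ := Finset.mk_mem_sym2_iff.1 hmem
      exact colorClass_adj.2 ⟨(cliqueColoring_of_mem hne ha hb).trans hj, hne⟩

end Construction

theorem exists_isCliqueFilling_of_card_le_one {A : Finset α} (hA : #A ≤ 1) (p : α → Option κ) :
    ∃ c, IsCliqueFilling A p c ∧ ∀ i, p i = none → ∀ a ∈ A, c s(a, i) = none := by
  classical
  refine ⟨cliqueColoring A p p p fun _ => none,
    isCliqueFilling_cliqueColoring (fun _ _ _ => id) (fun _ _ _ => id) fun j => ?_,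
    fun i hi a ha => ?_⟩
  · refine or_iff_not_imp_left.2 fun hport => ⟨fun b hb => ?_, fun x hx y hy => ?_⟩
    · exact not_imp_comm.1 (fun hbA => ⟨b, hbA, hb⟩) hport
    · rw [Finset.card_le_one.1 hA x hx y hy]
  · by_cases hiA : i ∈ A
    · rw [Finset.card_le_one.1 hA a ha i hiA, cliqueColoring_self, hi]
    · rw [cliqueColoring_of_notMem ha hiA, hi]

section Zigzag

theorem zigzag_preconnected {s : ℕ} [NeZero s] {H : SimpleGraph (ZMod s)} (c : ZMod s)
    (hH : ∀ x y, x ≠ y → x + y = c ∨ x + y = c + 1 → H.Adj x y) : H.Preconnected := by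
  have reachable_of_sum (x y : ZMod s) (h : x + y = c ∨ x + y = c + 1) : H.Reachable x y := by
    rcases eq_or_ne x y with rfl | hne
    · rfl
    · exact (hH x y hne h).reachable
  have reachable_succ (x : ZMod s) : H.Reachable x (x + 1) :=
    (reachable_of_sum x (c - x) (.inl (by ring))).trans
      (reachable_of_sum (c - x) (x + 1) (.inr (by ring)))
  have reachable_add (x : ZMod s) (k : ℕ) : H.Reachable x (x + k) := by
    induction k with
    | zero => simp
    | succ k ih => rw [Nat.cast_succ, ← add_assoc]; exact ih.trans (reachable_succ _)
  intro x y
  simpa using reachable_add x (y - x).val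

variable {A : Finset α} {a₀ : α}

theorem exists_equiv_zmod (ha₀ : a₀ ∈ A) : ∃ e : A ≃ ZMod #A, e ⟨a₀, ha₀⟩ = 0 := by
  have : NeZero #A := ⟨Finset.card_ne_zero_of_mem ha₀⟩
  let e : A ≃ ZMod #A := Fintype.equivOfCardEq (by rw [Fintype.card_coe, ZMod.card])
  exact ⟨e.trans (Equiv.subRight (e ⟨a₀, ha₀⟩)), sub_self _⟩

/-- The colouring of the edges of a complete graph on `A ≃ ZMod #A` by the value of
`(e a + e b - 1) / 2`. The colours `t < #A / 2` are the zigzag paths of Walecki's decomposition. -/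
def zigzagColoring [DecidableEq α] (e : A ≃ ZMod #A) : Sym2 α → ℕ :=
  Sym2.lift ⟨fun a b =>
    if h : a ∈ A ∧ b ∈ A then (e ⟨a, h.1⟩ + e ⟨b, h.2⟩ - 1).val / 2 else 0, fun a b => by
      simp only [and_comm (a := a ∈ A), add_comm]⟩

variable [DecidableEq α]

theorem zigzagColoring_coe (e : A ≃ ZMod #A) (a b : A) :
    zigzagColoring e s((a : α), (b : α)) = (e a + e b - 1).val / 2 := by
  simp [zigzagColoring]

theorem reachable_zigzagColoring (e : A ≃ ZMod #A) {t : ℕ} (ht : t < #A / 2) {x y : α}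
    (hx : x ∈ A) (hy : y ∈ A) :
    (SimpleGraph.fromEdgeSet {d | d ∈ A.sym2 ∧ zigzagColoring e d = t}).Reachable x y := by
  have : NeZero #A := ⟨Finset.card_ne_zero_of_mem hx⟩
  let G := SimpleGraph.fromEdgeSet {d | d ∈ A.sym2 ∧ zigzagColoring e d = t}
  let H : SimpleGraph (ZMod #A) := G.comap fun i => (e.symm i : α)
  have hH : H.Preconnected := by
    refine zigzag_preconnected ((2 * t + 1 : ℕ) : ZMod #A) fun i i' hne hsum => ?_
    refine (SimpleGraph.fromEdgeSet_adj _).2 ⟨⟨by simp, ?_⟩, by simpa using hne⟩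
    rw [zigzagColoring_coe, e.apply_symm_apply, e.apply_symm_apply]
    rcases hsum with h | h
    · have : i + i' - 1 = (2 * t : ℕ) := by rw [h]; push_cast; ring
      rw [this, ZMod.val_natCast_of_lt (by lia)]
      lia
    · have : i + i' - 1 = (2 * t + 1 : ℕ) := by rw [h]; push_cast; ring
      rw [this, ZMod.val_natCast_of_lt (by lia)]
      lia
  have hG : G.Reachable (e.symm (e ⟨x, hx⟩)) (e.symm (e ⟨y, hy⟩)) :=
    (hH (e ⟨x, hx⟩) (e ⟨y, hy⟩)).map ⟨fun i => (e.symm i : α), id⟩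
  rwa [e.symm_apply_apply, e.symm_apply_apply] at hG

theorem exists_zigzagColoring_eq_of_odd (hA : Odd #A) {e : A ≃ ZMod #A} {ha₀ : a₀ ∈ A}
    (he : e ⟨a₀, ha₀⟩ = 0) {a : α} (ha : a ∈ A) :
    ∃ b ∈ A, zigzagColoring e s(a, b) = #A / 2 ∧ (a = b → a = a₀) := by
  have : NeZero #A := ⟨Finset.card_ne_zero_of_mem ha⟩
  let b := e.symm (-e ⟨a, ha⟩)
  have hb : e b = -e ⟨a, ha⟩ := e.apply_symm_apply _
  refine ⟨b, b.2, ?_, fun hab => ?_⟩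
  · rw [zigzagColoring_coe e ⟨a, ha⟩ b, hb]
    obtain ⟨k, hk⟩ := hA
    have : e ⟨a, ha⟩ + -e ⟨a, ha⟩ - 1 = (2 * k : ℕ) := by
      have card_eq_zero : ((2 * k + 1 : ℕ) : ZMod #A) = 0 := hk ▸ ZMod.natCast_self #A
      push_cast at card_eq_zero ⊢
      linear_combination -card_eq_zero
    rw [this, ZMod.val_natCast_of_lt (by lia)]
    lia
  · have hab : (⟨a, ha⟩ : A) = b := Subtype.ext hab
    have hsum : e ⟨a, ha⟩ + e ⟨a, ha⟩ = 0 :=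
      add_eq_zero_iff_eq_neg.2 ((congrArg e hab).trans hb)
    have := (ZMod.add_self_eq_zero_iff_eq_zero hA).1 hsum
    exact congrArg Subtype.val (e.injective (this.trans he.symm))

end Zigzag

section Connectors

variable [Fintype α] [DecidableEq α] {A : Finset α} {p : α → Option κ}

/-- The disjoint ways of connecting the vertices of `A` inside the complete graph on `α`: the star
at a vertex `b` outside `A`, written `inl b`, and the zigzag path of number `t`, written `inr t`. -/
def connectors (A : Finset α) : Finset (α ⊕ ℕ) :=
  Aᶜ.disjSum (Finset.range (#A / 2))

theorem inl_mem_connectors {b : α} : Sum.inl b ∈ connectors A ↔ b ∉ A := by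
  simp [connectors]

theorem inr_mem_connectors {t : ℕ} : Sum.inr t ∈ connectors A ↔ t < #A / 2 := by
  simp [connectors]

theorem card_connectors_add (A : Finset α) :
    #(connectors A) + (#A + 1) / 2 = Fintype.card α := by
  have := A.card_le_univ
  rw [connectors, Finset.card_disjSum, Finset.card_compl, Finset.card_range]
  lia

/-- Every colour `j` gets a connector `slot j` of its own, which is able to carry all the ports of
colour `j`: a zigzag path reaches only the ports inside `A`. -/
structure IsConnectorAssignment (A : Finset α) (p : α → Option κ) (slot : κ → α ⊕ ℕ) : Prop where
  injective : Injective slot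
  mem : ∀ j, slot j ∈ connectors A
  port_inl : ∀ {j b}, slot j = .inl b → ∀ j', p b = some j' → j' = j
  port_inr : ∀ {j t}, slot j = .inr t → ∀ b, p b = some j → b ∈ A

/-- The colouring in which every colour `j` takes the edges of the connector `slot j`, and joins the
ports of colour `j` outside `A` to it. -/
noncomputable def connectorColoring [DecidableEq κ] (A : Finset α) (p : α → Option κ)
    (slot : κ → α ⊕ ℕ) (e : A ≃ ZMod #A) : Sym2 α → Option κ :=
  cliqueColoring A p (fun b => partialInv slot (.inl b))
    (fun b => (partialInv slot (.inl b)).or (p b))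
    fun d => partialInv slot (.inr (zigzagColoring e d))

theorem IsConnectorAssignment.isCliqueFilling [DecidableEq κ] {slot : κ → α ⊕ ℕ}
    (hslot : IsConnectorAssignment A p slot) (e : A ≃ ZMod #A) :
    IsCliqueFilling A p (connectorColoring A p slot e) := by
  refine isCliqueFilling_cliqueColoring (fun b _ j hj => ?_) (fun b _ j hj => ?_) fun j => ?_
  · rcases h : partialInv slot (.inl b) with _ | j'
    · exact hj
    · have := hslot.port_inl ((hslot.injective.isPartialInv _ _).1 h) j hj
      simp [this]
  · simp [hj]
  · rcases h : slot j with b | t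
    · exact .inl ⟨b, inl_mem_connectors.1 (h ▸ hslot.mem j), (hslot.injective.isPartialInv _ _).2 h⟩
    · refine .inr ⟨hslot.port_inr h, fun x hx y hy => ?_⟩
      refine (reachable_zigzagColoring e (inr_mem_connectors.1 (h ▸ hslot.mem j)) hx hy).mono ?_
      refine SimpleGraph.fromEdgeSet_mono fun d ⟨hd, hdt⟩ => ⟨hd, ?_⟩
      rw [hdt]
      exact (hslot.injective.isPartialInv _ _).2 h

theorem partialInv_eq_none {β γ : Type*} {f : β → γ} (hf : Injective f) {y : γ}
    (hy : ∀ x, f x ≠ y) : partialInv f y = none :=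
  Option.eq_none_iff_forall_ne_some.2 fun x h => hy x ((hf.isPartialInv _ _).1 h)

theorem IsConnectorAssignment.exists_free_of_ne [DecidableEq κ] {slot : κ → α ⊕ ℕ}
    (hslot : IsConnectorAssignment A p slot) (hA : 2 ≤ #A) (e : A ≃ ZMod #A) {x : α ⊕ ℕ}
    (hxA : x ∈ connectors A) (hx : ∀ j, slot j ≠ x) {a : α} (ha : a ∈ A) :
    ∃ b, connectorColoring A p slot e s(a, b) = none := by
  have hnone := partialInv_eq_none hslot.injective hx
  cases x with
  | inl b => exact ⟨b, (cliqueColoring_of_notMem ha (inl_mem_connectors.1 hxA)).trans hnone⟩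
  | inr t =>
    obtain ⟨a', ha', hne⟩ := Finset.exists_mem_ne hA a
    obtain ⟨b, hab, -⟩ := exists_adj_dist_lt
      (reachable_zigzagColoring e (inr_mem_connectors.1 hxA) ha ha') hne.symm
    obtain ⟨⟨hmem, hab⟩, hne⟩ := (SimpleGraph.fromEdgeSet_adj _).1 hab
    refine ⟨b, (cliqueColoring_of_mem hne ha (Finset.mk_mem_sym2_iff.1 hmem).2).trans ?_⟩
    rw [hab, hnone]

/-- The coloured ports outside `A`. -/
def outerPorts (A : Finset α) (p : α → Option κ) : Finset α :=
  {b ∈ Aᶜ | (p b).isSome}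

/-- The connectors left over when every coloured port outside `A` claims the star at its vertex. -/
def unclaimedConnectors (A : Finset α) (p : α → Option κ) : Finset (α ⊕ ℕ) :=
  connectors A \ (outerPorts A p).map .inl

theorem card_unclaimedConnectors_add (A : Finset α) (p : α → Option κ) :
    #(unclaimedConnectors A p) + #(outerPorts A p) + (#A + 1) / 2 = Fintype.card α := by
  have hsub : (outerPorts A p).map .inl ⊆ connectors A := by
    intro x hx
    obtain ⟨b, hb, rfl⟩ := Finset.mem_map.1 hx
    exact inl_mem_connectors.2 (Finset.mem_compl.1 (Finset.mem_filter.1 hb).1)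
  rw [← card_connectors_add A, ← Finset.card_sdiff_add_card_eq_card hsub, Finset.card_map,
    unclaimedConnectors]

theorem eq_none_of_inl_mem_unclaimedConnectors {b : α}
    (hb : Sum.inl b ∈ unclaimedConnectors A p) : p b = none := by
  obtain ⟨hbA, hb⟩ := Finset.mem_sdiff.1 hb
  simpa [outerPorts, inl_mem_connectors.1 hbA] using hb

variable [Fintype κ] [DecidableEq κ]

/-- The colours without a port outside `A`. -/
def innerColors (A : Finset α) (p : α → Option κ) : Finset κ :=
  {j | ∀ b, p b = some j → b ∈ A}

theorem exists_isConnectorAssignment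
    (h : #(innerColors A p) + #(outerPorts A p) + (#A + 1) / 2 ≤ Fintype.card α) :
    ∃ slot, IsConnectorAssignment A p slot := by
  have hcard : #(innerColors A p) ≤ #(unclaimedConnectors A p) := by
    have := card_unclaimedConnectors_add A p
    lia
  obtain ⟨f⟩ : Nonempty (innerColors A p ↪ unclaimedConnectors A p) :=
    Function.Embedding.nonempty_of_card_le (by simpa using hcard)
  have exists_outer (j : κ) (hj : j ∉ innerColors A p) : ∃ b ∉ A, p b = some j := by
    simpa [innerColors, and_comm] using hj
  choose g hgA hg using exists_outer
  let slot (j : κ) : α ⊕ ℕ := if hj : j ∈ innerColors A p then f ⟨j, hj⟩ else .inl (g j hj)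
  have slot_inner {j : κ} (hj : j ∈ innerColors A p) : slot j = f ⟨j, hj⟩ := dif_pos hj
  have slot_outer {j : κ} (hj : j ∉ innerColors A p) : slot j = .inl (g j hj) := dif_neg hj
  have slot_mem {j : κ} (hj : j ∈ innerColors A p) : slot j ∈ unclaimedConnectors A p :=
    slot_inner hj ▸ (f ⟨j, hj⟩).2
  have port_inl {j : κ} {b : α} (hb : slot j = .inl b) (j' : κ) (hj' : p b = some j') : j' = j := by
    by_cases hj : j ∈ innerColors A p
    · have := eq_none_of_inl_mem_unclaimedConnectors (hb ▸ slot_mem hj)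
      simp [this] at hj'
    · obtain rfl := Sum.inl_injective ((slot_outer hj).symm.trans hb)
      exact Option.some_injective _ (hj'.symm.trans (hg j hj))
  refine ⟨slot, fun j j' hjj' => ?_, fun j => ?_, port_inl, fun {j t} ht => ?_⟩
  · by_cases hj : j ∈ innerColors A p
    · by_cases hj' : j' ∈ innerColors A p
      · rw [slot_inner hj, slot_inner hj'] at hjj'
        exact congrArg Subtype.val (f.injective (Subtype.ext hjj'))
      · exact (port_inl (hjj'.trans (slot_outer hj')) j' (hg j' hj')).symm
    · exact port_inl (hjj'.symm.trans (slot_outer hj)) j (hg j hj)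
  · by_cases hj : j ∈ innerColors A p
    · exact Finset.sdiff_subset (slot_mem hj)
    · exact slot_outer hj ▸ inl_mem_connectors.2 (hgA j hj)
  · by_cases hj : j ∈ innerColors A p
    · simpa [innerColors] using hj
    · simp [slot_outer hj] at ht

/-- A numerical condition under which a clique with terminals `A` and ports coloured by `p` has a
filling leaving an edge or port of every terminal uncoloured: there is a connector for every colour,
and one connector, all ports of terminals, or, for odd `#A`, one port of a terminal is left over. -/
structure IsFillable (A : Finset α) (p : α → Option κ) : Prop where
  card_le : #(innerColors A p) + #(outerPorts A p) + (#A + 1) / 2 ≤ Fintype.card α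
  free : Fintype.card κ + (#A + 1) / 2 < Fintype.card α ∨ (∀ a ∈ A, p a = none) ∨
    Odd #A ∧ ∃ a ∈ A, p a = none

theorem IsFillable.exists_isCliqueFilling (h : IsFillable A p) (hA : 2 ≤ #A) :
    ∃ c, IsCliqueFilling A p c ∧ ∀ a ∈ A, ∃ b, c s(a, b) = none := by
  obtain ⟨slot, hslot⟩ := exists_isConnectorAssignment h.card_le
  obtain ⟨a₀, ha₀, hfree⟩ : ∃ a₀ ∈ A, Fintype.card κ + (#A + 1) / 2 < Fintype.card α ∨
      (∀ a ∈ A, p a = none) ∨ Odd #A ∧ p a₀ = none := by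
    rcases h.free with h | h | ⟨hodd, a, ha, hpa⟩
    · obtain ⟨a, ha⟩ := Finset.card_pos.1 (zero_lt_two.trans_le hA)
      exact ⟨a, ha, .inl h⟩
    · obtain ⟨a, ha⟩ := Finset.card_pos.1 (zero_lt_two.trans_le hA)
      exact ⟨a, ha, .inr (.inl h)⟩
    · exact ⟨a, ha, .inr (.inr ⟨hodd, hpa⟩)⟩
  obtain ⟨e, he⟩ := exists_equiv_zmod ha₀
  refine ⟨_, hslot.isCliqueFilling e, fun a ha => ?_⟩
  rcases hfree with hcard | hports | ⟨hodd, hport⟩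
  · have himage : #(Finset.univ.image slot) < #(connectors A) := by
      have := card_connectors_add A
      have := Finset.card_image_le (s := Finset.univ) (f := slot)
      rw [Finset.card_univ] at this
      lia
    obtain ⟨x, hxA, hx⟩ := Finset.exists_mem_notMem_of_card_lt_card himage
    exact hslot.exists_free_of_ne hA e hxA (by simpa using hx) ha
  · exact ⟨a, (cliqueColoring_self a).trans (hports a ha)⟩
  · obtain ⟨b, hb, hab, haa₀⟩ := exists_zigzagColoring_eq_of_odd hodd he ha
    refine ⟨b, ?_⟩
    rcases eq_or_ne a b with rfl | hne
    · exact (cliqueColoring_self a).trans (haa₀ rfl ▸ hport)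
    · refine (cliqueColoring_of_mem hne ha hb).trans (partialInv_eq_none hslot.injective ?_)
      intro j hj
      have := inr_mem_connectors.1 (hj ▸ hslot.mem j)
      lia

theorem exists_isCliqueFilling_free (hport : A.Nonempty → ∃ i, p i = none)
    (h : 2 ≤ #A → IsFillable A p) :
    ∃ c, IsCliqueFilling A p c ∧ ∀ a ∈ A, ∃ b, c s(a, b) = none := by
  rcases le_or_gt #A 1 with hle | hlt
  · obtain ⟨c, hc, hci⟩ := exists_isCliqueFilling_of_card_le_one hle p
    refine ⟨c, hc, fun a ha => ?_⟩
    obtain ⟨i, hi⟩ := hport ⟨a, ha⟩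
    exact ⟨i, hci i hi a ha⟩
  · exact (h hlt).exists_isCliqueFilling hlt

end Connectors

end CliqueFilling

section Ports

variable {n ℓ : ℕ} {α κ : Type*}

/-- The edge of the Sierpiński graph between `w` and `w'` leaves `w` through the port `i` and
enters `w'` through the port `i'`: the words `w i` and `w' i'` are adjacent one level up. -/
def PortAdj (w : Fin n → α) (i : α) (w' : Fin n → α) (i' : α) : Prop :=
  ∃ d : Fin n, (∀ j, j < d → w j = w' j) ∧ w d ≠ w' d ∧
    (∀ j, d < j → w j = w' d ∧ w' j = w d) ∧ i = w' d ∧ i' = w d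

theorem PortAdj.symm {w w' : Fin n → α} {i i' : α} (h : PortAdj w i w' i') :
    PortAdj w' i' w i := by
  obtain ⟨d, h₁, h₂, h₃, h₄, h₅⟩ := h
  exact ⟨d, fun j hj => (h₁ j hj).symm, h₂.symm, fun j hj => (h₃ j hj).symm, h₅, h₄⟩

theorem PortAdj.ne {w w' : Fin n → α} {i i' : α} (h : PortAdj w i w' i') : w ≠ w' := by
  obtain ⟨d, -, h, -⟩ := h
  exact fun hw => h (congrFun hw d)

theorem PortAdj.port_unique {w w' : Fin n → α} {a a' b b' : α} (h : PortAdj w a w' a')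
    (h' : PortAdj w b w' b') : a = b := by
  obtain ⟨d, h₁, h₂, -, rfl, -⟩ := h
  obtain ⟨e, g₁, g₂, -, rfl, -⟩ := h'
  rcases lt_trichotomy d e with hd | rfl | hd
  · exact absurd (g₁ d hd) h₂
  · rfl
  · exact absurd (h₁ e hd) g₂

theorem PortAdj.adj {w w' : Fin n → Fin ℓ} {i i' : Fin ℓ} (h : PortAdj w i w' i') :
    (sierpinskiGraph n ℓ).Adj w w' := by
  obtain ⟨d, h₁, h₂, h₃, -⟩ := h
  exact ⟨d, h₁, h₂, h₃⟩

theorem portAdj_succ_iff {u v : Fin (n + 1) → α} {i i' : α} :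
    PortAdj u i v i' ↔
      (Fin.init u = Fin.init v ∧ u (Fin.last n) ≠ v (Fin.last n) ∧
        i = v (Fin.last n) ∧ i' = u (Fin.last n)) ∨
      (PortAdj (Fin.init u) (u (Fin.last n)) (Fin.init v) (v (Fin.last n)) ∧
        i = u (Fin.last n) ∧ i' = v (Fin.last n)) := by
  constructor
  · rintro ⟨d, h₁, h₂, h₃, h₄, h₅⟩
    induction d using Fin.lastCases with
    | last => exact .inl ⟨funext fun j => h₁ _ (Fin.castSucc_lt_last j), h₂, h₄, h₅⟩
    | cast d =>
      obtain ⟨hu, hv⟩ := h₃ (Fin.last n) (Fin.castSucc_lt_last d)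
      exact .inr ⟨⟨d, fun j hj => h₁ _ hj, h₂, fun j hj => h₃ _ hj, hu, hv⟩,
        h₄.trans hu.symm, h₅.trans hv.symm⟩
  · rintro (⟨h, hne, hi, hi'⟩ | ⟨⟨d, h₁, h₂, h₃, hu, hv⟩, hi, hi'⟩)
    · refine ⟨Fin.last n, fun j hj => ?_, hne, fun j hj => absurd hj ?_, hi, hi'⟩
      · obtain ⟨j, rfl⟩ := Fin.exists_castSucc_eq.2 hj.ne
        exact congrFun h j
      · exact (Fin.le_last j).not_gt
    · refine ⟨d.castSucc, fun j hj => ?_, h₂, fun j hj => ?_, hi.trans hu, hi'.trans hv⟩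
      · obtain ⟨j, rfl⟩ := Fin.exists_castSucc_eq.2 (hj.trans_le (Fin.le_last _)).ne
        exact h₁ j hj
      · induction j using Fin.lastCases with
        | last => exact ⟨hu, hv⟩
        | cast j => exact h₃ j hj

theorem portAdj_snoc {w : Fin n → α} {a b : α} (hab : a ≠ b) :
    PortAdj (Fin.snoc w a : Fin (n + 1) → α) b (Fin.snoc w b : Fin (n + 1) → α) a :=
  portAdj_succ_iff.2 <| .inl <| by simp [hab]

theorem PortAdj.snoc {w w' : Fin n → α} {i i' : α} (h : PortAdj w i w' i') :
    PortAdj (Fin.snoc w i : Fin (n + 1) → α) i (Fin.snoc w' i' : Fin (n + 1) → α) i' :=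
  portAdj_succ_iff.2 <| .inr <| by simpa using h

/-- The edges of colour `j`, where an edge has colour `j` when the colouring `U` of the ports gives
colour `j` to both of its ports. -/
def portClass (U : (Fin n → α) → α → Option κ) (j : κ) : SimpleGraph (Fin n → α) where
  Adj w w' := ∃ i i', PortAdj w i w' i' ∧ U w i = some j ∧ U w' i' = some j
  symm := ⟨fun _ _ ⟨i, i', h, hi, hi'⟩ => ⟨i', i, h.symm, hi', hi⟩⟩
  loopless := ⟨fun _ ⟨_, _, h, _⟩ => h.ne rfl⟩

/-- The port colouring `U` encodes edge-disjoint subgraphs `portClass U j` that connect `S` and have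
no common vertex outside `S`. A port of `w` without an edge, where `w` is a constant word, counts
as an edge, because the next level of the recursion continues through it. -/
structure IsPortPacking (S : Finset (Fin n → α)) (U : (Fin n → α) → α → Option κ) : Prop where
  port_eq : ∀ {w i w' i'}, PortAdj w i w' i' → U w i = U w' i'
  disj : ∀ w ∉ S, ∀ i i' j j', U w i = some j → U w i' = some j' → j = j'
  conn : ∀ j, ∀ w ∈ S, ∀ w' ∈ S, (portClass U j).Reachable w w'

theorem isPortPacking_none {S : Finset (Fin n → α)} (hS : #S ≤ 1) :
    IsPortPacking (κ := κ) S fun _ _ => none where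
  port_eq _ := rfl
  disj _ _ _ _ _ _ h := by cases h
  conn j w hw w' hw' := by rw [Finset.card_le_one.1 hS w hw w' hw']

theorem IsPortPacking.exists_port {S : Finset (Fin n → α)} {U : (Fin n → α) → α → Option κ}
    (hU : IsPortPacking S U) (hS : 2 ≤ #S) {w : Fin n → α} (hw : w ∈ S) (j : κ) :
    ∃ i, U w i = some j := by
  obtain ⟨w', hw', hne⟩ := Finset.exists_mem_ne hS w
  obtain ⟨_, i, _, -, hi, -⟩ := mem_support_of_reachable_of_ne (hU.conn j w hw w' hw') hne.symm
  exact ⟨i, hi⟩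

theorem IsPortPacking.exists_internallyDisjointTrees {m : ℕ} {S : Finset (Fin n → Fin ℓ)}
    (hS : S.Nonempty) {U : (Fin n → Fin ℓ) → Fin ℓ → Option (Fin m)} (hU : IsPortPacking S U) :
    ∃ T : Fin m → (sierpinskiGraph n ℓ).Subgraph,
      InternallyDisjointTrees (sierpinskiGraph n ℓ) S T := by
  refine exists_internallyDisjointTrees_of_reachable (H := portClass U)
    (fun j w w' ⟨_, _, h, _⟩ => h.adj) hS hU.conn (fun j j' hne => ?_) (fun j j' hne => ?_)
  · rw [SimpleGraph.disjoint_left]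
    rintro w w' ⟨i, _, h, hi, -⟩ ⟨i', _, h', hi', -⟩
    rw [h.port_unique h', hi'] at hi
    exact hne (Option.some_injective _ hi).symm
  · rintro w ⟨⟨_, i, _, -, hi, -⟩, ⟨_, i', _, -, hi', -⟩⟩
    by_contra hw
    exact hne (hU.disj w hw i i' j j' hi hi')

/-- The port colouring on the words of length `n + 1` obtained by colouring, for every word `w` of
length `n`, the clique of its extensions by `c w`. -/
def liftPorts (c : (Fin n → α) → Sym2 α → Option κ) (u : Fin (n + 1) → α) (b : α) : Option κ :=
  c (Fin.init u) s(u (Fin.last n), b)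

theorem reachable_snoc_of_reachable_colorClass {c : (Fin n → α) → Sym2 α → Option κ} {j : κ}
    {w : Fin n → α} {a b : α} (h : (colorClass (c w) j).Reachable a b) :
    (portClass (liftPorts c) j).Reachable (Fin.snoc w a) (Fin.snoc w b) := by
  refine h.map ⟨fun a => (Fin.snoc w a : Fin (n + 1) → α), fun {a b} hab => ?_⟩
  obtain ⟨hc, hne⟩ := colorClass_adj.1 hab
  exact ⟨b, a, portAdj_snoc hne, by simpa [liftPorts] using hc,
    by simpa [liftPorts, Sym2.eq_swap] using hc⟩

section Terminals

variable [Fintype α] [DecidableEq α]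

/-- The letters extending the word `w` to a word in `S`. -/
def terminalsAt (S : Finset (Fin (n + 1) → α)) (w : Fin n → α) : Finset α :=
  {a | (Fin.snoc w a : Fin (n + 1) → α) ∈ S}

variable {S : Finset (Fin (n + 1) → α)}

theorem mem_terminalsAt {w : Fin n → α} {a : α} :
    a ∈ terminalsAt S w ↔ (Fin.snoc w a : Fin (n + 1) → α) ∈ S := by
  simp [terminalsAt]

theorem last_mem_terminalsAt_init {u : Fin (n + 1) → α} :
    u (Fin.last n) ∈ terminalsAt S (Fin.init u) ↔ u ∈ S := by
  rw [mem_terminalsAt, Fin.snoc_init_self]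

theorem reachable_liftPorts {U : (Fin n → α) → α → Option κ}
    {c : (Fin n → α) → Sym2 α → Option κ}
    (hc : ∀ w, IsCliqueFilling (terminalsAt S w) (U w) (c w)) {j : κ} {w w' : Fin n → α}
    (h : (portClass U j).Reachable w w') {x y : α} (hx : x ∈ terminalsAt S w ∨ U w x = some j)
    (hy : y ∈ terminalsAt S w' ∨ U w' y = some j) :
    (portClass (liftPorts c) j).Reachable (Fin.snoc w x) (Fin.snoc w' y) := by
  obtain ⟨p⟩ := h
  induction p generalizing x with
  | nil => exact reachable_snoc_of_reachable_colorClass ((hc _).conn j x y hx hy)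
  | @cons w v _ hwv _ ih =>
    obtain ⟨i, i', hport, hi, hi'⟩ := hwv
    have inside : (portClass (liftPorts c) j).Reachable (Fin.snoc w x) (Fin.snoc w i) :=
      reachable_snoc_of_reachable_colorClass ((hc w).conn j x i hx (.inr hi))
    have across : (portClass (liftPorts c) j).Adj (Fin.snoc w i) (Fin.snoc v i') :=
      ⟨i, i', hport.snoc, by simpa [liftPorts, (hc w).diag] using hi,
        by simpa [liftPorts, (hc v).diag] using hi'⟩
    exact (inside.trans across.reachable).trans (ih (.inr hi') hy)

theorem IsPortPacking.lift {S' : Finset (Fin n → α)} (hS : ∀ u ∈ S, Fin.init u ∈ S')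
    {U : (Fin n → α) → α → Option κ} (hU : IsPortPacking S' U)
    {c : (Fin n → α) → Sym2 α → Option κ}
    (hc : ∀ w, IsCliqueFilling (terminalsAt S w) (U w) (c w)) :
    IsPortPacking S (liftPorts c) where
  port_eq {u i v i'} h := by
    rcases portAdj_succ_iff.1 h with ⟨hinit, -, rfl, rfl⟩ | ⟨hport, rfl, rfl⟩
    · rw [liftPorts, liftPorts, hinit, Sym2.eq_swap]
    · rw [liftPorts, liftPorts, (hc _).diag, (hc _).diag, hU.port_eq hport]
  disj u hu i i' j j' hi hi' :=
    (hc _).disj _ (mt last_mem_terminalsAt_init.1 hu) i i' j j' hi hi'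
  conn j u hu v hv := by
    rw [← Fin.snoc_init_self u, ← Fin.snoc_init_self v]
    exact reachable_liftPorts hc (hU.conn j _ (hS u hu) _ (hS v hv))
      (.inl (last_mem_terminalsAt_init.2 hu)) (.inl (last_mem_terminalsAt_init.2 hv))

end Terminals

end Ports

section Thinning

variable {κ κ' : Type*} {f : κ → κ'} {n : ℕ} {α : Type*}

/-- The restriction of the colouring `p` to the colours in the range of `f`, renamed along `f`. -/
noncomputable def thin (f : κ → κ') (p : α → Option κ') (a : α) : Option κ :=
  (p a).bind (partialInv f)

theorem thin_eq_some (hf : Injective f) {p : α → Option κ'} {a : α} {j : κ} :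
    thin f p a = some j ↔ p a = some (f j) := by
  rw [thin, Option.bind_eq_some_iff]
  exact ⟨fun ⟨j', hj', hj⟩ => (hf.isPartialInv _ _).1 hj ▸ hj',
    fun h => ⟨f j, h, (hf.isPartialInv _ _).2 rfl⟩⟩

theorem thin_eq_none {p : α → Option κ'} {a : α} (h : p a = none) : thin f p a = none := by
  rw [thin, h, Option.bind_none]

theorem IsPortPacking.thin {S : Finset (Fin n → α)} {U : (Fin n → α) → α → Option κ'}
    (hU : IsPortPacking S U) (hf : Injective f) : IsPortPacking S fun w => thin f (U w) where
  port_eq h := by rw [SteinerPacking.thin, SteinerPacking.thin, hU.port_eq h]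
  disj w hw i i' j j' hi hi' :=
    hf (hU.disj w hw i i' (f j) (f j') ((thin_eq_some hf).1 hi) ((thin_eq_some hf).1 hi'))
  conn j w hw w' hw' := by
    refine (hU.conn (f j) w hw w' hw').mono ?_
    rintro _ _ ⟨i, i', h, hi, hi'⟩
    exact ⟨i, i', h, (thin_eq_some hf).2 hi, (thin_eq_some hf).2 hi'⟩

variable [Fintype α]

/-- The coloured ports. -/
def coloredPorts (p : α → Option κ) : Finset α :=
  {a | (p a).isSome}

theorem mem_coloredPorts {p : α → Option κ} {a : α} :
    a ∈ coloredPorts p ↔ ∃ j, p a = some j := by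
  simp [coloredPorts, Option.isSome_iff_exists]

theorem card_coloredPorts_lt {p : α → Option κ} {i : α} (hi : p i = none) :
    #(coloredPorts p) < Fintype.card α :=
  Finset.card_lt_univ_of_notMem (x := i) (by simp [mem_coloredPorts, hi])

theorem card_add_card_le_card_coloredPorts {p : α → Option κ} {P : Finset α}
    (hP : P ⊆ coloredPorts p) {J : Finset κ} (hJ : ∀ j ∈ J, ∃ a ∉ P, p a = some j) :
    #P + #J ≤ #(coloredPorts p) := by
  classical
  choose g hgP hg using fun j : J => hJ j j.2
  have hg_inj : Injective g := fun j j' h =>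
    Subtype.ext (Option.some_injective _ ((hg j).symm.trans (h ▸ hg j')))
  have hdisj : Disjoint P (Finset.univ.image g) := by
    rw [Finset.disjoint_right]
    intro a ha
    obtain ⟨j, -, rfl⟩ := Finset.mem_image.1 ha
    exact hgP j
  rw [← Fintype.card_coe J, ← Finset.card_univ, ← Finset.card_image_of_injective _ hg_inj,
    ← Finset.card_union_of_disjoint hdisj]
  refine Finset.card_le_card (Finset.union_subset hP fun a ha => ?_)
  obtain ⟨j, -, rfl⟩ := Finset.mem_image.1 ha
  exact mem_coloredPorts.2 ⟨j, hg j⟩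

theorem card_innerColors_add_card_outerPorts_le [DecidableEq α] [Fintype κ] [DecidableEq κ]
    {p : α → Option κ} (hp : ∀ j, ∃ a, p a = some j) (A : Finset α) :
    #(innerColors A p) + #(outerPorts A p) ≤ #(coloredPorts p) := by
  rw [add_comm]
  refine card_add_card_le_card_coloredPorts
    (Finset.filter_subset_filter _ (Finset.subset_univ _)) fun j hj => ?_
  obtain ⟨a, ha⟩ := hp j
  have haA : a ∈ A := (Finset.mem_filter.1 hj).2 a ha
  exact ⟨a, fun hmem => Finset.mem_compl.1 (Finset.mem_filter.1 hmem).1 haA, ha⟩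

theorem card_coloredPorts_thin_add_card_le [Fintype κ] [Fintype κ'] (hf : Injective f)
    {p : α → Option κ'} (hp : ∀ j, ∃ a, p a = some j) :
    #(coloredPorts (thin f p)) + Fintype.card κ' ≤ #(coloredPorts p) + Fintype.card κ := by
  classical
  have hremoved : #(coloredPorts (thin f p)) + #(Finset.univ.image f)ᶜ ≤ #(coloredPorts p) := by
    refine card_add_card_le_card_coloredPorts (fun a ha => ?_) fun j' hj' => ?_
    · obtain ⟨j, hj⟩ := mem_coloredPorts.1 ha
      exact mem_coloredPorts.2 ⟨f j, (thin_eq_some hf).1 hj⟩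
    · obtain ⟨a, ha⟩ := hp j'
      refine ⟨a, fun hmem => ?_, ha⟩
      obtain ⟨j, hj⟩ := mem_coloredPorts.1 hmem
      have : f j = j' := Option.some_injective _ (((thin_eq_some hf).1 hj).symm.trans ha)
      exact Finset.mem_compl.1 hj' (Finset.mem_image.2 ⟨j, Finset.mem_univ j, this⟩)
  rw [Finset.card_compl, Finset.card_image_of_injective _ hf, Finset.card_univ] at hremoved
  have := Fintype.card_le_of_injective f hf
  lia

end Thinning

section Recursion

variable {n : ℕ} {α : Type*} [Fintype α] [DecidableEq α] {S : Finset (Fin (n + 1) → α)}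
  {w w' : Fin n → α}

theorem terminalsAt_nonempty_iff : (terminalsAt S w).Nonempty ↔ w ∈ S.image Fin.init := by
  rw [Finset.mem_image]
  constructor
  · rintro ⟨a, ha⟩
    exact ⟨_, mem_terminalsAt.1 ha, by simp⟩
  · rintro ⟨u, hu, rfl⟩
    exact ⟨_, last_mem_terminalsAt_init.2 hu⟩

theorem card_eq_sum_card_terminalsAt (S : Finset (Fin (n + 1) → α)) :
    #S = ∑ w ∈ S.image Fin.init, #(terminalsAt S w) := by
  rw [Finset.card_eq_sum_card_image Fin.init S]
  refine Finset.sum_congr rfl fun w _ => ?_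
  refine Finset.card_nbij' (fun u => u (Fin.last n)) (fun a => Fin.snoc w a) ?_ ?_ ?_ ?_
  · intro u hu
    obtain ⟨huS, rfl⟩ := Finset.mem_filter.1 (Finset.mem_coe.1 hu)
    exact last_mem_terminalsAt_init.2 huS
  · intro a ha
    exact Finset.mem_filter.2 ⟨mem_terminalsAt.1 ha, Fin.init_snoc _ _⟩
  · intro u hu
    obtain ⟨-, rfl⟩ := Finset.mem_filter.1 (Finset.mem_coe.1 hu)
    exact Fin.snoc_init_self u
  · intro a _
    exact Fin.snoc_last _ _

theorem card_terminalsAt_add_card_image_init_le (hw : w ∈ S.image Fin.init) :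
    #(terminalsAt S w) + #(S.image Fin.init) ≤ #S + 1 := by
  have hsum := card_eq_sum_card_terminalsAt S
  rw [← Finset.add_sum_erase _ _ hw] at hsum
  have hothers := Finset.card_nsmul_le_sum ((S.image Fin.init).erase w)
    (fun w => #(terminalsAt S w)) 1 fun x hx =>
      (terminalsAt_nonempty_iff.2 (Finset.mem_of_mem_erase hx)).card_pos
  have := Finset.card_erase_add_one hw
  rw [smul_eq_mul, mul_one] at hothers
  lia

theorem card_terminalsAt_add_card_terminalsAt_le (hw : w ∈ S.image Fin.init)
    (hw' : w' ∈ S.image Fin.init) (hne : w ≠ w') :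
    #(terminalsAt S w) + #(terminalsAt S w') ≤ #S := by
  rw [card_eq_sum_card_terminalsAt S, ← Finset.sum_pair (f := fun w => #(terminalsAt S w)) hne]
  exact Finset.sum_le_sum_of_subset (Finset.insert_subset hw (Finset.singleton_subset_iff.2 hw'))

theorem exists_injective_forall_ne {κ κ' : Type*} [Fintype κ] [Fintype κ']
    (h : Fintype.card κ < Fintype.card κ') (j₀ : κ') :
    ∃ f : κ → κ', Injective f ∧ ∀ j, f j ≠ j₀ := by
  classical
  obtain ⟨f⟩ : Nonempty (κ ↪ {j : κ' // j ≠ j₀}) :=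
    Function.Embedding.nonempty_of_card_le (by simpa using Nat.le_sub_one_of_lt h)
  exact ⟨fun j => f j, Subtype.val_injective.comp f.injective, fun j => (f j).2⟩

theorem exists_injective_thin_free {κ κ' : Type*} [Fintype κ] [Fintype κ']
    (hκ : Fintype.card κ = Fintype.card α - (#S + 1) / 2)
    (hκ' : Fintype.card κ' = Fintype.card α - (#(S.image Fin.init) + 1) / 2)
    (hS : 2 ≤ #(S.image Fin.init)) (hcard : #S ≤ Fintype.card α)
    (U : (Fin n → α) → α → Option κ') :
    ∃ f : κ → κ', Injective f ∧ ∀ w ∈ S.image Fin.init, 2 ≤ #(terminalsAt S w) →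
      Fintype.card κ + (#(terminalsAt S w) + 1) / 2 < Fintype.card α ∨
        (∀ a ∈ terminalsAt S w, thin f (U w) a = none) ∨
        Odd #(terminalsAt S w) ∧ ∃ a ∈ terminalsAt S w, thin f (U w) a = none := by
  have himage : #(S.image Fin.init) ≤ #S := Finset.card_image_le
  by_cases htight : ∃ w ∈ S.image Fin.init, 2 ≤ #(terminalsAt S w) ∧
    Fintype.card α ≤ Fintype.card κ + (#(terminalsAt S w) + 1) / 2 ∧
    ∃ a ∈ terminalsAt S w, ∃ j, U w a = some j
  · -- The clique at `w` is the only one with so many terminals, so one free port there is enough.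
    obtain ⟨w, hw, htwo, hle, a, ha, j₀, hj₀⟩ := htight
    have hwS := card_terminalsAt_add_card_image_init_le hw
    obtain ⟨f, hf, hfj₀⟩ := exists_injective_forall_ne (κ := κ) (by lia) j₀
    refine ⟨f, hf, fun w' hw' _ => ?_⟩
    rcases eq_or_ne w w' with rfl | hne
    · refine .inr (.inr ⟨Nat.odd_iff.2 (by lia), a, ha, ?_⟩)
      refine Option.eq_none_iff_forall_ne_some.2 fun j hj => hfj₀ j ?_
      exact Option.some_injective _ (((thin_eq_some hf).1 hj).symm.trans hj₀)
    · have := card_terminalsAt_add_card_terminalsAt_le hw hw' hne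
      exact .inl (by lia)
  · push Not at htight
    obtain ⟨f⟩ : Nonempty (κ ↪ κ') := Function.Embedding.nonempty_of_card_le (by lia)
    refine ⟨f, f.injective, fun w hw htwo => ?_⟩
    rcases lt_or_ge (Fintype.card κ + (#(terminalsAt S w) + 1) / 2) (Fintype.card α) with h | h
    · exact .inl h
    · exact .inr (.inl fun a ha =>
        thin_eq_none (Option.eq_none_iff_forall_ne_some.2 (htight w hw htwo h a ha)))

theorem exists_fillable_packing_of_card_image_init_eq_one {κ : Type*} [Fintype κ] [DecidableEq κ]
    (hκ : Fintype.card κ = Fintype.card α - (#S + 1) / 2) (hcard : #S ≤ Fintype.card α)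
    (hS : #(S.image Fin.init) = 1) :
    ∃ U : (Fin n → α) → α → Option κ, IsPortPacking (S.image Fin.init) U ∧
      ∀ w ∈ S.image Fin.init, (∃ i, U w i = none) ∧
        (2 ≤ #(terminalsAt S w) → IsFillable (terminalsAt S w) (U w)) := by
  refine ⟨_, isPortPacking_none hS.le, fun w hw => ⟨?_, fun _ => ⟨?_, .inr (.inl fun _ _ => rfl)⟩⟩⟩
  · obtain ⟨a, -⟩ := terminalsAt_nonempty_iff.2 hw
    exact ⟨a, rfl⟩
  · have := card_terminalsAt_add_card_image_init_le hw
    simp only [innerColors, outerPorts, reduceCtorEq, false_imp_iff, implies_true,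
      Finset.filter_true, Finset.card_univ, Option.isSome_none, Bool.false_eq_true,
      Finset.filter_false, Finset.card_empty, add_zero]
    lia

theorem exists_fillable_packing_of_two_le_card_image_init {κ κ' : Type*} [Fintype κ]
    [DecidableEq κ] [Fintype κ']
    (hκ : Fintype.card κ = Fintype.card α - (#S + 1) / 2)
    (hκ' : Fintype.card κ' = Fintype.card α - (#(S.image Fin.init) + 1) / 2)
    (hS : 2 ≤ #(S.image Fin.init)) (hcard : #S ≤ Fintype.card α)
    {U : (Fin n → α) → α → Option κ'} (hU : IsPortPacking (S.image Fin.init) U)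
    (hfree : ∀ w ∈ S.image Fin.init, ∃ i, U w i = none) :
    ∃ U : (Fin n → α) → α → Option κ, IsPortPacking (S.image Fin.init) U ∧
      ∀ w ∈ S.image Fin.init, (∃ i, U w i = none) ∧
        (2 ≤ #(terminalsAt S w) → IsFillable (terminalsAt S w) (U w)) := by
  obtain ⟨f, hf, hthin⟩ := exists_injective_thin_free hκ hκ' hS hcard U
  refine ⟨_, hU.thin hf, fun w hw => ?_⟩
  obtain ⟨i, hi⟩ := hfree w hw
  refine ⟨⟨i, thin_eq_none hi⟩, fun htwo => ⟨?_, hthin w hw htwo⟩⟩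
  have exists_port := hU.exists_port hS hw
  have hcolored := card_innerColors_add_card_outerPorts_le (p := thin f (U w))
    (fun j => (exists_port (f j)).imp fun _ => (thin_eq_some hf).2) (terminalsAt S w)
  have hremoved := card_coloredPorts_thin_add_card_le hf exists_port
  have hlt := card_coloredPorts_lt hi
  have hwS := card_terminalsAt_add_card_image_init_le hw
  lia

end Recursion

theorem exists_isPortPacking_free {n : ℕ} {α : Type*} [Fintype α] (S : Finset (Fin n → α))
    (hS : S.Nonempty) (hcard : #S ≤ Fintype.card α)
    {m : ℕ} (hm : m = Fintype.card α - (#S + 1) / 2) :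
    ∃ U : (Fin n → α) → α → Option (Fin m), IsPortPacking S U ∧ ∀ w ∈ S, ∃ i, U w i = none := by
  classical
  induction n generalizing m with
  | zero =>
    have : Nonempty α := Fintype.card_pos_iff.1 (hS.card_pos.trans_le hcard)
    exact ⟨_, isPortPacking_none (by simpa using S.card_le_univ),
      fun _ _ => ⟨Classical.arbitrary α, rfl⟩⟩
  | succ n ih =>
    obtain ⟨U, hU, hfill⟩ : ∃ U : (Fin n → α) → α → Option (Fin m),
        IsPortPacking (S.image Fin.init) U ∧ ∀ w ∈ S.image Fin.init, (∃ i, U w i = none) ∧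
          (2 ≤ #(terminalsAt S w) → IsFillable (terminalsAt S w) (U w)) := by
      have hκ : Fintype.card (Fin m) = Fintype.card α - (#S + 1) / 2 := by simpa using hm
      obtain hone | htwo : #(S.image Fin.init) = 1 ∨ 2 ≤ #(S.image Fin.init) := by
        have := (hS.image Fin.init).card_pos
        lia
      · exact exists_fillable_packing_of_card_image_init_eq_one hκ hcard hone
      · obtain ⟨U, hU, hfree⟩ := ih _ (hS.image _) (Finset.card_image_le.trans hcard) rfl
        exact exists_fillable_packing_of_two_le_card_image_init hκ (by simp) htwo hcard hU hfree
    choose c hc hcfree using fun w => exists_isCliqueFilling_free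
      (fun hw => (hfill w (terminalsAt_nonempty_iff.1 hw)).1) fun htwo =>
        (hfill w (terminalsAt_nonempty_iff.1 (Finset.card_pos.1 (by lia)))).2 htwo
    exact ⟨_, hU.lift (fun u => Finset.mem_image_of_mem _) hc,
      fun u hu => hcfree _ _ (last_mem_terminalsAt_init.2 hu)⟩

theorem terminalsAt_univ {n : ℕ} {α : Type*} [Fintype α] [DecidableEq α] (w : Fin n → α) :
    terminalsAt Finset.univ w = Finset.univ := by
  simp [terminalsAt]

theorem exists_isPortPacking_univ {α : Type*} [Fintype α] [Nonempty α] (n : ℕ) {m : ℕ}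
    (hm : m ≤ Fintype.card α / 2) :
    ∃ U : (Fin n → α) → α → Option (Fin m), IsPortPacking Finset.univ U := by
  classical
  induction n with
  | zero => exact ⟨_, isPortPacking_none (by simp)⟩
  | succ n ih =>
    obtain ⟨U, hU⟩ := ih
    obtain ⟨e, -⟩ := exists_equiv_zmod (Finset.mem_univ (Classical.arbitrary α))
    have exists_filling (w : Fin n → α) :
        ∃ c, IsCliqueFilling (terminalsAt Finset.univ w) (U w) c := by
      obtain ⟨slot, hslot⟩ := exists_isConnectorAssignment (A := Finset.univ) (p := U w) (by
        have hinner := (innerColors Finset.univ (U w)).card_le_univ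
        have houter : outerPorts Finset.univ (U w) = ∅ := by simp [outerPorts]
        rw [Fintype.card_fin] at hinner
        rw [houter, Finset.card_empty, Finset.card_univ]
        lia)
      rw [terminalsAt_univ]
      exact ⟨_, hslot.isCliqueFilling e⟩
    choose c hc using exists_filling
    exact ⟨_, hU.lift (fun _ _ => Finset.mem_univ _) hc⟩

section Connectivity

variable {n ℓ k : ℕ}

theorem le_genConn_sierpinskiGraph (hk : 1 ≤ k) (hkℓ : k ≤ ℓ) :
    ((ℓ - (k + 1) / 2 : ℕ) : ℕ∞) ≤ genConn k (sierpinskiGraph n ℓ) := by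
  refine le_sInf ?_
  rintro _ ⟨S, rfl, rfl⟩
  have hS : S.Nonempty := Finset.card_pos.1 hk
  obtain ⟨U, hU, -⟩ := exists_isPortPacking_free S hS (by simpa using hkℓ)
    (m := ℓ - (#S + 1) / 2) (by simp)
  exact le_sSup ⟨_, rfl, hU.exists_internallyDisjointTrees hS⟩

theorem le_genEdgeConn_sierpinskiGraph (hℓ : 1 ≤ ℓ) (k : ℕ) :
    ((ℓ / 2 : ℕ) : ℕ∞) ≤ genEdgeConn k (sierpinskiGraph n ℓ) := by
  refine le_sInf ?_
  rintro _ ⟨S, -, rfl⟩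
  have : Nonempty (Fin ℓ) := ⟨⟨0, hℓ⟩⟩
  obtain ⟨U, hU⟩ := exists_isPortPacking_univ (α := Fin ℓ) n (m := ℓ / 2) (by simp)
  obtain ⟨T, hT⟩ := hU.exists_internallyDisjointTrees Finset.univ_nonempty
  exact le_sSup ⟨_, rfl, T, hT.edgeDisjointTrees.mono (Finset.subset_univ S)⟩

theorem apply_eq_of_adj_of_zero_ne {u v : Fin (n + 1) → Fin ℓ}
    (h : (sierpinskiGraph (n + 1) ℓ).Adj u v) (hne : u 0 ≠ v 0) {j : Fin (n + 1)} (hj : j ≠ 0) :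
    u j = v 0 := by
  obtain ⟨d, hlt, -, hgt⟩ := h
  obtain rfl : d = 0 := by
    by_contra hd
    exact hne (hlt 0 (Fin.pos_of_ne_zero hd))
  exact (hgt j (Fin.pos_of_ne_zero hj)).1

theorem eq_of_adj_of_zero_ne {u v u' v' : Fin (n + 1) → Fin ℓ}
    (h : (sierpinskiGraph (n + 1) ℓ).Adj u v) (h' : (sierpinskiGraph (n + 1) ℓ).Adj u' v')
    (hne : u 0 ≠ v 0) (hu : u 0 = u' 0) (hv : v 0 = v' 0) : u = u' := by
  funext j
  by_cases hj : j = 0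
  · rw [hj, hu]
  · rw [apply_eq_of_adj_of_zero_ne h hne hj,
      apply_eq_of_adj_of_zero_ne h' (hu ▸ hv ▸ hne) hj, hv]

theorem exists_finset_card_eq_of_forall_const {r : ℕ} (hrk : r ≤ k) (hk : k ≤ ℓ ^ (n + 1))
    {R : Finset (Fin ℓ)} (hR : #R = r) :
    ∃ S : Finset (Fin (n + 1) → Fin ℓ), #S = k ∧ ∀ a ∈ R, (fun _ => a) ∈ S := by
  classical
  obtain ⟨S, hRS, -, hS⟩ := Finset.exists_subsuperset_card_eq
    (Finset.subset_univ (R.image (Function.const (Fin (n + 1))))) (n := k)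
    (by rwa [Finset.card_image_of_injective _ Function.const_injective, hR])
    (by simpa using hk)
  exact ⟨S, hS, fun a ha => hRS (Finset.mem_image_of_mem _ ha)⟩

theorem genEdgeConn_sierpinskiGraph_le (hn : 1 ≤ n) {r : ℕ} (hr : 2 ≤ r) (hrℓ : r ≤ ℓ)
    (hrk : r ≤ k) (hk : k ≤ ℓ ^ n) :
    genEdgeConn k (sierpinskiGraph n ℓ) ≤ ((ℓ - (r + 1) / 2 : ℕ) : ℕ∞) := by
  obtain ⟨n, rfl⟩ := Nat.exists_eq_add_of_le' hn
  obtain ⟨R, -, hR⟩ := Finset.exists_subset_card_eq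
    (show r ≤ #(Finset.univ : Finset (Fin ℓ)) by simpa using hrℓ)
  obtain ⟨S, hS, hRS⟩ := exists_finset_card_eq_of_forall_const (n := n) hrk hk hR
  have hle : genEdgeConn k (sierpinskiGraph (n + 1) ℓ) ≤
      localEdgeConn (sierpinskiGraph (n + 1) ℓ) S := sInf_le ⟨S, hS, rfl⟩
  refine hle.trans (sSup_le ?_)
  rintro _ ⟨m, rfl, T, hT⟩
  have hm := hT.le_of_contraction (f := fun u => u 0) (R := R)
    (fun u v u' v' h h' hne hu hv => ⟨eq_of_adj_of_zero_ne h h' hne hu hv,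
      eq_of_adj_of_zero_ne h.symm h'.symm hne.symm hv hu⟩)
    (by lia) fun a ha => ⟨fun _ => a, hRS a ha, rfl⟩
  rw [Fintype.card_fin, hR] at hm
  exact_mod_cast hm

end Connectivity

theorem natCeil_div_two (k : ℕ) : ⌈(k : ℚ) / 2⌉₊ = (k + 1) / 2 := by
  refine eq_of_forall_ge_iff fun m => ?_
  rw [Nat.ceil_le, div_le_iff₀ two_pos]
  norm_cast
  lia

theorem natFloor_div_two (k : ℕ) : ⌊(k : ℚ) / 2⌋₊ = k / 2 := by
  exact_mod_cast Nat.floor_div_eq_div (K := ℚ) k 2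

end SteinerPacking

open SteinerPacking in
theorem theorem1p5_general (n ℓ : ℕ) (hn : 1 ≤ n) :
    (∀ k : ℕ, 2 ≤ k → k ≤ ℓ →
      genConn k (sierpinskiGraph n ℓ) = ((ℓ - ⌈(k : ℚ) / 2⌉₊ : ℕ) : ℕ∞) ∧
      genEdgeConn k (sierpinskiGraph n ℓ) = ((ℓ - ⌈(k : ℚ) / 2⌉₊ : ℕ) : ℕ∞)) ∧
    (∀ k : ℕ, ℓ + 1 ≤ k → k ≤ ℓ ^ n →
      genConn k (sierpinskiGraph n ℓ) ≤ (⌊(ℓ : ℚ) / 2⌋₊ : ℕ∞) ∧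
      genEdgeConn k (sierpinskiGraph n ℓ) = (⌊(ℓ : ℚ) / 2⌋₊ : ℕ∞)) := by
  refine ⟨fun k hk hkℓ => ?_, fun k hk hkn => ?_⟩
  · rw [natCeil_div_two]
    have hlow := le_genConn_sierpinskiGraph (n := n) (k := k) (by lia) hkℓ
    have hmid := genConn_le_genEdgeConn k (sierpinskiGraph n ℓ)
    have hup := genEdgeConn_sierpinskiGraph_le hn hk hkℓ le_rfl
      (hkℓ.trans (Nat.le_self_pow (by lia) ℓ))
    exact ⟨(hmid.trans hup).antisymm hlow, hup.antisymm (hlow.trans hmid)⟩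
  · rw [natFloor_div_two]
    have hℓ : 2 ≤ ℓ := by
      by_contra! hℓ
      have hpow : ℓ ^ n ≤ ℓ := by interval_cases ℓ <;> simp [Nat.ne_of_gt hn]
      lia
    have hmid := genConn_le_genEdgeConn k (sierpinskiGraph n ℓ)
    have hup := genEdgeConn_sierpinskiGraph_le hn hℓ le_rfl (by lia) hkn
    rw [show ℓ - (ℓ + 1) / 2 = ℓ / 2 by lia] at hup
    exact ⟨hmid.trans hup, hup.antisymm (le_genEdgeConn_sierpinskiGraph (by lia) k)⟩

theorem theorem1p5 (n ℓ : ℕ) (hn : 1 ≤ n) (hℓ : 3 ≤ ℓ) :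
    (∀ k : ℕ, 3 ≤ k → k ≤ ℓ →
      SteinerPacking.genConn k (SteinerPacking.sierpinskiGraph n ℓ) =
          ((ℓ - ⌈(k : ℚ) / 2⌉₊ : ℕ) : ℕ∞) ∧
      SteinerPacking.genEdgeConn k (SteinerPacking.sierpinskiGraph n ℓ) =
          ((ℓ - ⌈(k : ℚ) / 2⌉₊ : ℕ) : ℕ∞)) ∧
    (∀ k : ℕ, ℓ + 1 ≤ k → k ≤ ℓ ^ n →
      SteinerPacking.genConn k (SteinerPacking.sierpinskiGraph n ℓ) ≤
          (⌊(ℓ : ℚ) / 2⌋₊ : ℕ∞) ∧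
      SteinerPacking.genEdgeConn k (SteinerPacking.sierpinskiGraph n ℓ) =
          (⌊(ℓ : ℚ) / 2⌋₊ : ℕ∞)) :=
  ⟨fun k hk => (theorem1p5_general n ℓ hn).1 k (by lia), (theorem1p5_general n ℓ hn).2⟩
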